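/- For a Borel set $B\subset\mathbb R^3$ or $B\subset\mathbb C$ let $\mathcal M(B)$ be the set of Borel probability measures supported on $B$. Let $H^+=\{z\in\mathbb C:\Re z\ge 0\}$, and for $A\subset H^+$ let $$\Gamma(A)=\{(x\cos t,\,y,\,x\sin t)\ :\ x+iy\in A,\ 0\le t<2\pi\}\subset\mathbb R^3$$ be the set obtained by revolving $A$ about the $y$-axis. For a compact set $B\subset\mathbb R^3$ and $\mu\in\mathcal M(B)$ let $$I_0(\mu)=\iint \log\frac1{|p-q|}\,d\mu(p)\,d\mu(q)\in(-\infty,+\infty],$$ and let $\mathrm{cap}(B)=\exp\bigl(-\inf_{\mu\in\mathcal M(B)}I_0(\mu)\bigr)$ be the logarithmic capacity of $B$. For $z,w\in H^+$ let $$K(z,w)=\log\frac{2}{|z-w|+|z-w_*|},\qquad w_*=-\overline w,$$ with value $+\infty$ when $z=w$ lies on the $y$-axis, and for a compactly supported Borel probability measure $\nu$ on $H^+$ let $$J(\nu)=\iint K(z,w)\,d\nu(z)\,d\nu(w)\in(-\infty,+\infty].$$ Let $A\subset H^+$ be compact and non-degenerate, that is, $\mathrm{cap}(\Gamma(A))>0$.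 Then there is a unique measure $\mu_{\Gamma(A)}\in\mathcal M(\Gamma(A))$ (the logarithmic equilibrium measure of $\Gamma(A)$) that minimizes $I_0$ over $\mathcal M(\Gamma(A))$. Let $\lambda_A$ be its push-forward under $(x,y,\zeta)\mapsto\sqrt{x^2+\zeta^2}+iy$, that is, $\lambda_A(B)=\mu_{\Gamma(A)}(\Gamma(B))$ for every Borel set $B\subset H^+$. Then $\lambda_A\in\mathcal M(A)$, and $\lambda_A$ is the unique measure in $\mathcal M(A)$ that minimizes $J$ over $\mathcal M(A)$. -/

import Mathlib

open MeasureTheory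

noncomputable section

namespace RevolutionEnergy

/-- Euclidean three-space, with coordinates `(x, y, ζ) = (p 0, p 1, p 2)`. -/
abbrev R3 : Type := EuclideanSpace ℝ (Fin 3)

/-- The integral `∫ f⁺ dμ - ∫ f⁻ dμ` of an extended-real-valued function. It is used only for
functions which are bounded below almost everywhere with respect to a finite measure, so that the
second term is finite. -/
def extIntegral {X : Type*} [MeasurableSpace X] (μ : Measure X) (f : X → EReal) : EReal :=
  ((∫⁻ x, (f x).toENNReal ∂μ : ENNReal) : EReal) -
    ((∫⁻ x, (-f x).toENNReal ∂μ : ENNReal) : EReal)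

/-- The set of Borel probability measures supported on `B` (for closed `B`). -/
def probOn {X : Type*} [MeasurableSpace X] (B : Set X) : Set (Measure X) :=
  {μ | IsProbabilityMeasure μ ∧ μ Bᶜ = 0}

/-- The energy `∬ k(x, y) dμ(x) dμ(y)` of `μ` for the kernel `k`. -/
def energy {X : Type*} [MeasurableSpace X] (k : X → X → EReal) (μ : Measure X) : EReal :=
  extIntegral (μ.prod μ) fun p => k p.1 p.2

/-- `μ` minimizes the `k`-energy over all probability measures supported on `B`. -/
def IsEnergyMinimizer {X : Type*} [MeasurableSpace X] (k : X → X → EReal) (B : Set X)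
    (μ : Measure X) : Prop :=
  μ ∈ probOn B ∧ IsMinOn (energy k) (probOn B) μ

/-- The logarithmic kernel `log (1 / |p - q|)`, equal to `+∞` on the diagonal. -/
def logKernel (p q : R3) : EReal := ENNReal.log (1 / edist p q)

/-- The logarithmic capacity `exp (-V)` of a compact set `B`, where `V` is the infimum of the
logarithmic energies of the probability measures supported on `B`. -/
def logCapacity (B : Set R3) : ENNReal :=
  EReal.exp (-(⨅ μ ∈ probOn B, energy logKernel μ))

/-- The closed right half-plane `[0, ∞) × ℝ`, as a subset of `ℂ`. -/
def rightHalfPlane : Set ℂ := {z | 0 ≤ z.re}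

/-- The rotation of three-space about the `y`-axis through the angle `t`. -/
def rotation (t : ℝ) (p : R3) : R3 :=
  !₂[p 0 * Real.cos t - p 2 * Real.sin t, p 1, p 0 * Real.sin t + p 2 * Real.cos t]

/-- The set obtained by revolving `A` about the `y`-axis. -/
def revolution (A : Set ℂ) : Set R3 :=
  {p | ∃ z ∈ A, ∃ t ∈ Set.Ico 0 (2 * Real.pi), rotation t !₂[z.re, z.im, 0] = p}

/-- `A` is non-degenerate: its surface of revolution has positive logarithmic capacity. -/
def NonDegenerate (A : Set ℂ) : Prop := 0 < logCapacity (revolution A)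

/-- The point of the right half-plane whose rotations about the `y`-axis pass through `p`. -/
def profile (p : R3) : ℂ := ⟨Real.sqrt (p 0 ^ 2 + p 2 ^ 2), p 1⟩

/-- The push-forward of `μ` to the half-plane; it is given by `B ↦ μ (revolution B)` for Borel
subsets `B` of the half-plane, see `reducedMeasure_apply`. -/
def reducedMeasure (μ : Measure R3) : Measure ℂ := μ.map profile

/-- The reflection `w_* = -u + i v` of `w = u + i v` in the `y`-axis. -/
def reflect (w : ℂ) : ℂ := ⟨-w.re, w.im⟩

/-- The reduced kernel `log (2 / (|z - w| + |z - w_*|))`, equal to `+∞` if `z = w` lies on the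
`y`-axis. -/
def reducedKernel (z w : ℂ) : EReal := ENNReal.log (2 / (edist z w + edist z (reflect w)))

theorem measurable_profile : Measurable profile := by
  have h : Continuous profile := by
    have : profile = fun p : R3 =>
        Complex.equivRealProdCLM.symm (Real.sqrt (p 0 ^ 2 + p 2 ^ 2), p 1) := by
      funext p
      apply Complex.ext <;> simp [profile]
    rw [this]
    fun_prop
  exact h.measurable

theorem revolution_eq_preimage {B : Set ℂ} (hB : B ⊆ rightHalfPlane) :
    revolution B = profile ⁻¹' B := by
  ext p
  constructor
  · rintro ⟨z, hz, t, -, rfl⟩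
    have h0 : 0 ≤ z.re := hB hz
    have : profile (rotation t !₂[z.re, z.im, 0]) = z := by
      apply Complex.ext
      · have e : (z.re * Real.cos t) ^ 2 + (z.re * Real.sin t) ^ 2 = z.re ^ 2 := by
          nlinarith [Real.sin_sq_add_cos_sq t]
        simp [profile, rotation, e, Real.sqrt_sq h0]
      · simp [profile, rotation]
    simpa [this] using hz
  · intro hp
    set w : ℂ := ⟨p 0, p 2⟩ with hw
    have hn : ‖w‖ = Real.sqrt (p 0 ^ 2 + p 2 ^ 2) := by
      rw [Complex.norm_def, Complex.normSq_apply, hw]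
      simp [sq]
    have hc : ‖w‖ * Real.cos w.arg = p 0 := Complex.norm_mul_cos_arg w
    have hs : ‖w‖ * Real.sin w.arg = p 2 := Complex.norm_mul_sin_arg w
    refine ⟨profile p, hp, toIcoMod Real.two_pi_pos 0 w.arg, ?_, ?_⟩
    · simpa using toIcoMod_mem_Ico Real.two_pi_pos 0 w.arg
    · have e : toIcoMod Real.two_pi_pos 0 w.arg
          = w.arg - (toIcoDiv Real.two_pi_pos 0 w.arg : ℤ) * (2 * Real.pi) := by
        rw [toIcoMod, zsmul_eq_mul]
      have e1 : Real.cos (toIcoMod Real.two_pi_pos 0 w.arg) = Real.cos w.arg := by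
        rw [e, Real.cos_sub_int_mul_two_pi]
      have e2 : Real.sin (toIcoMod Real.two_pi_pos 0 w.arg) = Real.sin w.arg := by
        rw [e, Real.sin_sub_int_mul_two_pi]
      ext i
      fin_cases i <;> simp [rotation, profile, e1, e2, ← hn, hc, hs]

theorem reducedMeasure_apply (μ : Measure R3) {B : Set ℂ} (hB : B ⊆ rightHalfPlane)
    (hm : MeasurableSet B) : reducedMeasure μ B = μ (revolution B) := by
  rw [reducedMeasure, Measure.map_apply measurable_profile hm, revolution_eq_preimage hB]

end RevolutionEnergy

end

open Filter Topology
open scoped ENNReal NNReal InnerProductSpace ComplexConjugate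

noncomputable section

namespace RevolutionEnergy

/-! The reduced kernel is the average of the logarithmic kernel over rotations of one variable. Let
z, w be the profiles of p, q and m = (|z - w| + |z - w_*|)/2. If m > 0, then |p - R_t q| = m |e^{it}
- η| for some η with |η| ≤ 1 (`dist_rotation`, `norm_rotationCenter_le_one`), so by Jensen's formula
log |p - R_t q| has mean log m over t (`lintegral_shiftKernel_rotation`). Hence a rotation-invariant
measure has the same energy as its projection (`shiftEnergy_reducedMeasure`), and spreading ν
uniformly over the angle gives a measure on Γ(A) of energy J(ν) that projects to ν
(`shiftEnergy_liftMeasure`).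

The rest is existence and uniqueness on Γ(A); uniqueness makes the minimizer invariant, and carries
over to A through the lift. Existence is weak compactness plus lower semicontinuity
(`exists_minimizer_lintegral_prod`). Uniqueness comes from log (R/|p - q|) = ∫_0^∞ (exp(-t|p - q|²)
- exp(-tR²)) dt/(2t): each Gaussian kernel is strictly positive definite, because its quadratic form
on μ - ν is a weighted L² norm of the difference of characteristic functions
(`eq_of_mutualEnergy_le`, `eq_of_shiftEnergy_minimal`). Non-degeneracy provides the finite energy
that the equality case needs.

Adding one constant c to both kernels makes them nonnegative on the compact sets involved, so all
energies can be compared as `ℝ≥0∞`-valued integrals. -/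

/-! ### Shifting energies into the extended nonnegative reals -/

/-- The kernel `k + c`, truncated below at zero. -/
def shiftKernel {X : Type*} (c : ℝ) (k : X → X → EReal) (x y : X) : ℝ≥0∞ := (k x y + c).toENNReal

/-- The energy of the kernel `k + c`, as an extended nonnegative real number. -/
def shiftEnergy {X : Type*} [MeasurableSpace X] (c : ℝ) (k : X → X → EReal) (μ : Measure X) :
    ℝ≥0∞ :=
  ∫⁻ p, shiftKernel c k p.1 p.2 ∂(μ.prod μ)

/-- This is x + c = x⁺ - x⁻ + c arranged without subtraction, so that it survives x = ⊤ and can be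
integrated termwise. -/
theorem toENNReal_add_coe_add_toENNReal_neg {x : EReal} {c : ℝ} (hc : 0 ≤ c)
    (h : ((-c : ℝ) : EReal) ≤ x) :
    (x + c).toENNReal + (-x).toENNReal = x.toENNReal + ENNReal.ofReal c := by
  induction x with
  | bot => simp at h
  | top => simp
  | coe x =>
    have hx : -c ≤ x := by exact_mod_cast h
    rw [← EReal.coe_add, ← EReal.coe_neg]
    simp only [EReal.real_coe_toENNReal]
    rcases le_total 0 x with h0 | h0
    · rw [ENNReal.ofReal_of_nonpos (neg_nonpos.2 h0), add_zero, ENNReal.ofReal_add h0 hc]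
    · rw [ENNReal.ofReal_of_nonpos h0, zero_add, ← ENNReal.ofReal_add (by linarith) (by linarith)]
      congr 1
      ring

theorem extIntegral_eq_lintegral_add_sub {X : Type*} [MeasurableSpace X] (μ : Measure X)
    [IsProbabilityMeasure μ] {f : X → EReal} (hf : Measurable f) {c : ℝ} (hc : 0 ≤ c)
    (h : ∀ᵐ x ∂μ, ((-c : ℝ) : EReal) ≤ f x) :
    extIntegral μ f = ((∫⁻ x, (f x + c).toENNReal ∂μ : ℝ≥0∞) : EReal) - (c : EReal) := by
  have key : (∫⁻ x, (f x + c).toENNReal ∂μ) + ∫⁻ x, (-f x).toENNReal ∂μ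
      = (∫⁻ x, (f x).toENNReal ∂μ) + ENNReal.ofReal c := by
    have h1 : ∫⁻ x, ((f x).toENNReal + ENNReal.ofReal c) ∂μ
        = (∫⁻ x, (f x).toENNReal ∂μ) + ENNReal.ofReal c := by
      rw [lintegral_add_right _ measurable_const]
      simp
    rw [← h1, ← lintegral_add_right _ (by fun_prop)]
    refine lintegral_congr_ae ?_
    filter_upwards [h] with x hx
    exact toENNReal_add_coe_add_toENNReal_neg hc hx
  -- The negative part has finite integral, so it may be cancelled from `key`.
  have hN : ∫⁻ x, (-f x).toENNReal ∂μ ≤ ENNReal.ofReal c := by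
    calc ∫⁻ x, (-f x).toENNReal ∂μ ≤ ∫⁻ _, ENNReal.ofReal c ∂μ := by
          refine lintegral_mono_ae ?_
          filter_upwards [h] with x hx
          have : -f x ≤ (c : EReal) := by
            rw [EReal.neg_le]
            simpa using hx
          simpa using EReal.toENNReal_le_toENNReal this
      _ = ENNReal.ofReal c := by simp
  rw [extIntegral]
  generalize ∫⁻ x, (-f x).toENNReal ∂μ = N at key hN
  generalize ∫⁻ x, (f x).toENNReal ∂μ = P at key
  generalize ∫⁻ x, (f x + c).toENNReal ∂μ = L at key
  lift N to ℝ≥0 using ne_top_of_le_ne_top ENNReal.ofReal_ne_top hN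
  by_cases hP : P = ⊤
  · have hL : L = ⊤ := by
      by_contra hL
      rw [hP, top_add] at key
      exact (ENNReal.add_ne_top.2 ⟨hL, ENNReal.coe_ne_top⟩) key
    rw [hP, hL]
    simp
  · have hL : L ≠ ⊤ := by
      intro hL
      rw [hL, top_add] at key
      exact (ENNReal.add_ne_top.2 ⟨hP, ENNReal.ofReal_ne_top⟩) key.symm
    lift P to ℝ≥0 using hP
    lift L to ℝ≥0 using hL
    have key' : (L : ℝ) + N = P + c := by
      have := congrArg ENNReal.toReal key
      rw [ENNReal.toReal_add (by simp) (by simp), ENNReal.toReal_add (by simp) (by simp),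
        ENNReal.toReal_ofReal hc] at this
      simpa using this
    have e (a : ℝ≥0) : ((a : ℝ≥0∞) : EReal) = ((a : ℝ) : EReal) := rfl
    rw [e, e, e, ← EReal.coe_sub, ← EReal.coe_sub]
    congr 1
    linarith

theorem ae_prod_mem {X Y : Type*} [MeasurableSpace X] [MeasurableSpace Y] {μ : Measure X}
    {ν : Measure Y} [SFinite μ] [SFinite ν] {B : Set X} {C : Set Y}
    (hB : ∀ᵐ x ∂μ, x ∈ B) (hC : ∀ᵐ y ∂ν, y ∈ C) :
    ∀ᵐ p ∂(μ.prod ν), p.1 ∈ B ∧ p.2 ∈ C :=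
  (Measure.quasiMeasurePreserving_fst.ae hB).and (Measure.quasiMeasurePreserving_snd.ae hC)

theorem energy_eq_shiftEnergy_sub {X : Type*} [MeasurableSpace X] {k : X → X → EReal}
    (hk : Measurable fun p : X × X => k p.1 p.2) {B : Set X} {c : ℝ} (hc : 0 ≤ c)
    (hB : ∀ x ∈ B, ∀ y ∈ B, ((-c : ℝ) : EReal) ≤ k x y) {μ : Measure X} (hμ : μ ∈ probOn B) :
    energy k μ = (shiftEnergy c k μ : EReal) - (c : EReal) := by
  have := hμ.1
  have hμ' : ∀ᵐ x ∂μ, x ∈ B := hμ.2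
  refine extIntegral_eq_lintegral_add_sub _ hk hc ?_
  filter_upwards [ae_prod_mem hμ' hμ'] with p hp using hB _ hp.1 _ hp.2

theorem energy_le_energy_iff {X : Type*} [MeasurableSpace X] {k : X → X → EReal}
    (hk : Measurable fun p : X × X => k p.1 p.2) {B : Set X} {c : ℝ} (hc : 0 ≤ c)
    (hB : ∀ x ∈ B, ∀ y ∈ B, ((-c : ℝ) : EReal) ≤ k x y) {μ ν : Measure X} (hμ : μ ∈ probOn B)
    (hν : ν ∈ probOn B) :
    energy k μ ≤ energy k ν ↔ shiftEnergy c k μ ≤ shiftEnergy c k ν := by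
  rw [energy_eq_shiftEnergy_sub hk hc hB hμ, energy_eq_shiftEnergy_sub hk hc hB hν]
  refine ⟨fun h => ?_, fun h => EReal.sub_le_sub (EReal.coe_ennreal_le_coe_ennreal_iff.2 h) le_rfl⟩
  have := add_le_add_left h (c : EReal)
  rwa [EReal.sub_add_cancel, EReal.sub_add_cancel, EReal.coe_ennreal_le_coe_ennreal_iff] at this

/-- On measures carried by B the two energies differ by the finite constant c, which preserves
order. -/
theorem isEnergyMinimizer_iff {X : Type*} [MeasurableSpace X] {k : X → X → EReal}
    (hk : Measurable fun p : X × X => k p.1 p.2) {B : Set X} {c : ℝ} (hc : 0 ≤ c)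
    (hB : ∀ x ∈ B, ∀ y ∈ B, ((-c : ℝ) : EReal) ≤ k x y) {μ : Measure X} :
    IsEnergyMinimizer k B μ ↔
      μ ∈ probOn B ∧ ∀ ν ∈ probOn B, shiftEnergy c k μ ≤ shiftEnergy c k ν :=
  and_congr_right fun hμ => forall₂_congr fun _ hν => energy_le_energy_iff hk hc hB hμ hν

/-! ### Existence of minimizers -/

/-- The integral is the supremum over n of the integrals of the bounded continuous truncations
min(f, n), each weakly continuous in the measure. -/
theorem lowerSemicontinuous_lintegral {X : Type*} [TopologicalSpace X] [MeasurableSpace X]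
    [OpensMeasurableSpace X] {f : X → ℝ≥0∞} (hf : Continuous f) :
    LowerSemicontinuous fun μ : ProbabilityMeasure X => ∫⁻ x, f x ∂(μ : Measure X) := by
  have e (μ : ProbabilityMeasure X) : ∫⁻ x, f x ∂(μ : Measure X)
      = ⨆ n : ℕ, ∫⁻ x, min (f x) n ∂(μ : Measure X) := by
    rw [← lintegral_iSup (fun n => (hf.min continuous_const).measurable)]
    · refine lintegral_congr fun x => ?_
      rw [← inf_iSup_eq, ENNReal.iSup_natCast, inf_top_eq]
    · intro m n hmn x
      dsimp only
      gcongr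
  simp_rw [e]
  refine lowerSemicontinuous_iSup fun n => Continuous.lowerSemicontinuous ?_
  have hne (x : X) : min (f x) n ≠ ⊤ := ne_top_of_le_ne_top (by simp) (min_le_right _ _)
  let g : BoundedContinuousFunction X ℝ≥0 := BoundedContinuousFunction.mkOfBound
    ⟨fun x => (min (f x) n).toNNReal,
      ENNReal.continuousOn_toNNReal.comp_continuous (hf.min continuous_const) hne⟩ n (by
      intro x y
      have hb (x : X) : (min (f x) n).toNNReal ≤ n := by
        have := ENNReal.toNNReal_mono (ENNReal.natCast_ne_top n) (min_le_right (f x) n)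
        simpa using this
      have hx : ((min (f x) n).toNNReal : ℝ) ≤ n := by exact_mod_cast hb x
      have hy : ((min (f y) n).toNNReal : ℝ) ≤ n := by exact_mod_cast hb y
      have hx0 := (min (f x) n).toNNReal.coe_nonneg
      have hy0 := (min (f y) n).toNNReal.coe_nonneg
      rw [NNReal.dist_eq, abs_le]
      constructor <;> simp only [ContinuousMap.coe_mk] <;> linarith)
  have hg : ∀ μ : ProbabilityMeasure X, ∫⁻ x, min (f x) n ∂(μ : Measure X)
      = ∫⁻ x, g x ∂(μ : Measure X) := by
    intro μ
    refine lintegral_congr fun x => ?_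
    exact (ENNReal.coe_toNNReal (hne x)).symm
  simp_rw [hg]
  exact ProbabilityMeasure.continuous_lintegral_boundedContinuousFunction g

theorem exists_minimizer_lintegral_prod {X : Type*} [MetricSpace X] [SecondCountableTopology X]
    [MeasurableSpace X] [BorelSpace X] {f : X × X → ℝ≥0∞} (hf : Continuous f) {B : Set X}
    (hB : IsCompact B) (hne : (probOn B).Nonempty) :
    ∃ μ ∈ probOn B, ∀ ν ∈ probOn B, ∫⁻ p, f p ∂(μ.prod μ) ≤ ∫⁻ p, f p ∂(ν.prod ν) := by
  -- Prokhorov's tightness criterion with the constant sequences K_n = B and u_n = 0.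
  have hcpt : IsCompact {μ : ProbabilityMeasure X | ∀ n : ℕ, μ Bᶜ ≤ (0 : ℝ≥0)} :=
    isCompact_setOfPred_probabilityMeasure_mass_eq_compl_isCompact_le (u := fun _ => 0)
      (K := fun _ => B) tendsto_const_nhds (fun _ => hB) (Or.inl inferInstance)
  have hmem (μ : ProbabilityMeasure X) :
      μ ∈ {μ : ProbabilityMeasure X | ∀ n : ℕ, μ Bᶜ ≤ (0 : ℝ≥0)} ↔ (μ : Measure X) Bᶜ = 0 := by
    simp [ProbabilityMeasure.null_iff_toMeasure_null]
  have hlsc : LowerSemicontinuous fun μ : ProbabilityMeasure X =>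
      ∫⁻ p, f p ∂((μ : Measure X).prod μ) :=
    (lowerSemicontinuous_lintegral hf).comp
      (ProbabilityMeasure.continuous_prod.comp (continuous_id.prodMk continuous_id))
  obtain ⟨ν₀, hν₀⟩ := hne
  obtain ⟨μ, hμ, hmin⟩ := LowerSemicontinuousOn.exists_isMinOn
    ⟨⟨ν₀, hν₀.1⟩, (hmem ⟨ν₀, hν₀.1⟩).2 hν₀.2⟩ hcpt (hlsc.lowerSemicontinuousOn _)
  exact ⟨μ, ⟨μ.2, (hmem μ).1 hμ⟩, fun ν hν => hmin ((hmem ⟨ν, hν.1⟩).2 hν.2)⟩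

/-! ### Strict positive definiteness of Gaussian kernels -/

section Gaussian

variable {E : Type*} [NormedAddCommGroup E] [InnerProductSpace ℝ E] [FiniteDimensional ℝ E]
  [MeasurableSpace E] [BorelSpace E]

theorem integrable_exp_neg_mul_sq_norm {b : ℝ} (hb : 0 < b) :
    Integrable fun v : E => Real.exp (-b * ‖v‖ ^ 2) := by
  have h := GaussianFourier.integrable_cexp_neg_mul_sq_norm_add (V := E) (b := (b : ℂ))
    (by simpa using hb) 0 0
  refine h.norm.congr (Eventually.of_forall fun v => ?_)
  simp only [Complex.norm_exp]
  congr 1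
  simp [← Complex.ofReal_pow]

theorem integral_exp_neg_mul_sq_norm_mul_cos {b : ℝ} (hb : 0 < b) (w : E) :
    ∫ v : E, Real.exp (-b * ‖v‖ ^ 2) * Real.cos ⟪w, v⟫_ℝ
      = (Real.pi / b) ^ (Module.finrank ℝ E / 2 : ℝ) * Real.exp (-(4 * b)⁻¹ * ‖w‖ ^ 2) := by
  have hb' : 0 < (b : ℂ).re := by simpa using hb
  have h := GaussianFourier.integral_cexp_neg_mul_sq_norm_add hb' Complex.I w
  have hi := GaussianFourier.integrable_cexp_neg_mul_sq_norm_add hb' Complex.I w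
  have h2 := congrArg Complex.re h
  have h3 := integral_re hi
  simp only [RCLike.re_eq_complex_re] at h3
  rw [← h3] at h2
  have e1 (v : E) : (Complex.exp (-b * ‖v‖ ^ 2 + Complex.I * ⟪w, v⟫_ℝ)).re
      = Real.exp (-b * ‖v‖ ^ 2) * Real.cos ⟪w, v⟫_ℝ := by
    rw [Complex.exp_re]
    simp [← Complex.ofReal_pow]
  simp_rw [e1] at h2
  rw [h2]
  have e2 : ((Real.pi : ℂ) / b) ^ (Module.finrank ℝ E / 2 : ℂ)
      * Complex.exp (Complex.I ^ 2 * ‖w‖ ^ 2 / (4 * b))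
      = (((Real.pi / b) ^ (Module.finrank ℝ E / 2 : ℝ)
        * Real.exp (-(4 * b)⁻¹ * ‖w‖ ^ 2) : ℝ) : ℂ) := by
    rw [Complex.ofReal_mul, Complex.ofReal_cpow (by positivity), Complex.ofReal_exp]
    push_cast
    congr 2
    rw [Complex.I_sq]
    field_simp
  rw [e2, Complex.ofReal_re]

/-- The mutual energy of two measures with respect to a Gaussian kernel. -/
def gaussianEnergy (t : ℝ) (μ ν : Measure E) : ℝ :=
  ∫ p, Real.exp (-t * ‖p.1 - p.2‖ ^ 2) ∂(μ.prod ν)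

theorem re_charFun_mul_conj_charFun (μ ν : Measure E) [IsFiniteMeasure μ] [IsFiniteMeasure ν]
    (v : E) :
    (charFun μ v * conj (charFun ν v)).re = ∫ p, Real.cos ⟪p.1 - p.2, v⟫_ℝ ∂(μ.prod ν) := by
  rw [charFun_apply, charFun_apply, ← integral_conj, ← integral_prod_mul]
  have hi : Integrable (fun z : E × E => Complex.exp (⟪z.1, v⟫_ℝ * Complex.I)
      * conj (Complex.exp (⟪z.2, v⟫_ℝ * Complex.I))) (μ.prod ν) := by
    refine Integrable.of_bound (by fun_prop) 1 (Eventually.of_forall fun z => ?_)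
    simp [Complex.norm_exp_ofReal_mul_I]
  have h3 := integral_re hi
  simp only [RCLike.re_eq_complex_re] at h3
  rw [← h3]
  refine integral_congr_ae (Eventually.of_forall fun z => ?_)
  dsimp only
  rw [← Complex.exp_conj, ← Complex.exp_add, inner_sub_left, Complex.exp_re]
  simp
  ring_nf

/-- Fubini, and the fact that the Fourier transform of a Gaussian is a Gaussian. -/
theorem integral_exp_mul_re_charFun {b : ℝ} (hb : 0 < b) (μ ν : Measure E) [IsFiniteMeasure μ]
    [IsFiniteMeasure ν] :
    ∫ v : E, Real.exp (-b * ‖v‖ ^ 2) * (charFun μ v * conj (charFun ν v)).re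
      = (Real.pi / b) ^ (Module.finrank ℝ E / 2 : ℝ) * gaussianEnergy (4 * b)⁻¹ μ ν := by
  simp_rw [re_charFun_mul_conj_charFun, ← integral_const_mul]
  rw [integral_integral_swap, gaussianEnergy, ← integral_const_mul]
  · simp_rw [integral_exp_neg_mul_sq_norm_mul_cos hb]
  · refine ((integrable_exp_neg_mul_sq_norm (E := E) hb).comp_fst (μ.prod ν)).mono
      (Continuous.aestronglyMeasurable (by fun_prop)) (Eventually.of_forall fun z => ?_)
    simp only [Function.uncurry, norm_mul]
    exact mul_le_of_le_one_right (norm_nonneg _) (Real.abs_cos_le_one _)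

theorem integrable_exp_mul_re_charFun {b : ℝ} (hb : 0 < b) (μ ν : Measure E) [IsFiniteMeasure μ]
    [IsFiniteMeasure ν] :
    Integrable fun v : E => Real.exp (-b * ‖v‖ ^ 2) * (charFun μ v * conj (charFun ν v)).re := by
  have hμ := continuous_charFun (μ := μ)
  have hν := continuous_charFun (μ := ν)
  refine ((integrable_exp_neg_mul_sq_norm (E := E) hb).mul_const
    (μ.real Set.univ * ν.real Set.univ)).mono
    (Continuous.aestronglyMeasurable (by fun_prop)) (Eventually.of_forall fun v => ?_)
  rw [norm_mul, norm_mul]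
  gcongr
  rw [Real.norm_of_nonneg (by positivity : (0 : ℝ) ≤ μ.real Set.univ * ν.real Set.univ)]
  refine (Complex.abs_re_le_norm _).trans ?_
  rw [norm_mul, Complex.norm_conj]
  gcongr <;> exact norm_charFun_le _

theorem integral_exp_mul_norm_charFun_sub_sq {b : ℝ} (hb : 0 < b) (μ ν : Measure E)
    [IsFiniteMeasure μ] [IsFiniteMeasure ν] :
    Integrable (fun v : E => Real.exp (-b * ‖v‖ ^ 2) * ‖charFun μ v - charFun ν v‖ ^ 2) ∧
    ∫ v : E, Real.exp (-b * ‖v‖ ^ 2) * ‖charFun μ v - charFun ν v‖ ^ 2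
      = (Real.pi / b) ^ (Module.finrank ℝ E / 2 : ℝ) * (gaussianEnergy (4 * b)⁻¹ μ μ
        + gaussianEnergy (4 * b)⁻¹ ν ν - 2 * gaussianEnergy (4 * b)⁻¹ μ ν) := by
  have e (v : E) : Real.exp (-b * ‖v‖ ^ 2) * ‖charFun μ v - charFun ν v‖ ^ 2
      = Real.exp (-b * ‖v‖ ^ 2) * (charFun μ v * conj (charFun μ v)).re
        + Real.exp (-b * ‖v‖ ^ 2) * (charFun ν v * conj (charFun ν v)).re
        - 2 * (Real.exp (-b * ‖v‖ ^ 2) * (charFun μ v * conj (charFun ν v)).re) := by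
    rw [← Complex.normSq_eq_norm_sq, Complex.normSq_sub, Complex.mul_conj, Complex.mul_conj,
      Complex.ofReal_re, Complex.ofReal_re]
    ring
  have h1 := integrable_exp_mul_re_charFun hb μ μ
  have h2 := integrable_exp_mul_re_charFun hb ν ν
  have h3 := integrable_exp_mul_re_charFun hb μ ν
  have h12 : Integrable fun v : E => Real.exp (-b * ‖v‖ ^ 2)
      * (charFun μ v * conj (charFun μ v)).re
        + Real.exp (-b * ‖v‖ ^ 2) * (charFun ν v * conj (charFun ν v)).re := h1.add h2
  simp_rw [e]
  refine ⟨h12.sub (h3.const_mul 2), ?_⟩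
  rw [integral_sub h12 (h3.const_mul 2), integral_add h1 h2, integral_const_mul,
    integral_exp_mul_re_charFun hb, integral_exp_mul_re_charFun hb, integral_exp_mul_re_charFun hb]
  ring

theorem two_mul_gaussianEnergy_le {t : ℝ} (ht : 0 < t) (μ ν : Measure E)
    [IsFiniteMeasure μ] [IsFiniteMeasure ν] :
    2 * gaussianEnergy t μ ν ≤ gaussianEnergy t μ μ + gaussianEnergy t ν ν := by
  have hb : 0 < (4 * t)⁻¹ := by positivity
  have h := (integral_exp_mul_norm_charFun_sub_sq hb μ ν).2
  have h0 : 0 ≤ ∫ v : E, Real.exp (-(4 * t)⁻¹ * ‖v‖ ^ 2) * ‖charFun μ v - charFun ν v‖ ^ 2 :=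
    integral_nonneg fun v => by positivity
  have e : (4 * (4 * t)⁻¹)⁻¹ = t := by field_simp
  rw [h, e] at h0
  have := nonneg_of_mul_nonneg_right h0 (by positivity)
  linarith

/-- The weighted L² norm of the difference of characteristic functions vanishes; the weight is
positive and the functions are continuous, so they agree everywhere. -/
theorem eq_of_two_mul_gaussianEnergy_eq {t : ℝ} (ht : 0 < t) {μ ν : Measure E}
    [IsFiniteMeasure μ] [IsFiniteMeasure ν]
    (h : 2 * gaussianEnergy t μ ν = gaussianEnergy t μ μ + gaussianEnergy t ν ν) : μ = ν := by
  have hb : 0 < (4 * t)⁻¹ := by positivity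
  obtain ⟨hi, hint⟩ := integral_exp_mul_norm_charFun_sub_sq hb μ ν
  have e : (4 * (4 * t)⁻¹)⁻¹ = t := by field_simp
  rw [e, ← h, sub_self, mul_zero, integral_eq_zero_iff_of_nonneg (fun v => by positivity) hi]
    at hint
  have hμ := continuous_charFun (μ := μ)
  have hν := continuous_charFun (μ := ν)
  have := (Continuous.ae_eq_iff_eq volume (by fun_prop) continuous_const).1 hint
  refine Measure.ext_of_charFun (funext fun v => ?_)
  have hv : Real.exp (-(4 * t)⁻¹ * ‖v‖ ^ 2) * ‖charFun μ v - charFun ν v‖ ^ 2 = 0 :=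
    congrFun this v
  exact sub_eq_zero.1 (norm_eq_zero.1 (pow_eq_zero_iff two_ne_zero |>.1
    ((mul_eq_zero.1 hv).resolve_left (Real.exp_ne_zero _))))

end Gaussian

/-! ### The logarithm as a mixture of exponentials -/

theorem lintegral_exp_neg_mul_Ioi {s : ℝ} (hs : 0 < s) :
    ∫⁻ t in Set.Ioi (0 : ℝ), ENNReal.ofReal (Real.exp (-t * s)) = ENNReal.ofReal s⁻¹ := by
  have hi : IntegrableOn (fun t : ℝ => Real.exp (-s * t)) (Set.Ioi 0) := exp_neg_integrableOn_Ioi 0 hs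
  have h := integral_exp_mul_Ioi (a := -s) (by linarith) 0
  simp only [mul_zero, Real.exp_zero] at h
  have e : ∀ t : ℝ, Real.exp (-t * s) = Real.exp (-s * t) := fun t => by ring_nf
  simp_rw [e]
  rw [← ofReal_integral_eq_lintegral_ofReal hi (Eventually.of_forall fun t => (Real.exp_pos _).le),
    h, neg_div_neg_eq, one_div]

theorem lintegral_exp_neg_mul_Ioc {t u D : ℝ} (ht : 0 < t) (huD : u ≤ D) :
    ∫⁻ s in Set.Ioc u D, ENNReal.ofReal (Real.exp (-t * s))
      = ENNReal.ofReal ((Real.exp (-t * u) - Real.exp (-t * D)) / t) := by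
  have hc : Continuous fun s : ℝ => Real.exp (-t * s) := by fun_prop
  rw [← ofReal_integral_eq_lintegral_ofReal
    ((hc.intervalIntegrable u D).1) (Eventually.of_forall fun t => (Real.exp_pos _).le),
    ← intervalIntegral.integral_of_le huD]
  congr 1
  rw [intervalIntegral.integral_comp_mul_left (fun s => Real.exp s) (neg_ne_zero.2 ht.ne'),
    integral_exp, smul_eq_mul]
  field_simp
  ring

theorem lintegral_inv_Ioc {u D : ℝ} (hu : 0 < u) (huD : u ≤ D) :
    ∫⁻ s in Set.Ioc u D, ENNReal.ofReal s⁻¹ = ENNReal.ofReal (Real.log D - Real.log u) := by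
  have h0 : (0 : ℝ) ∉ Set.uIcc u D := by
    rw [Set.uIcc_of_le huD]
    exact fun h => absurd h.1 (not_le.2 hu)
  have hi := intervalIntegral.intervalIntegrable_inv (μ := volume) (a := u) (b := D)
    (f := fun x => x) (fun x hx h => h0 (h ▸ hx)) continuousOn_id
  rw [← ofReal_integral_eq_lintegral_ofReal hi.1, ← intervalIntegral.integral_of_le huD,
    integral_inv h0, Real.log_div (by linarith) hu.ne']
  filter_upwards [ae_restrict_mem measurableSet_Ioc] with s hs
  exact inv_nonneg.2 (hu.trans hs.1).le

/-- The density of the representation of the logarithm as a mixture of exponentials. -/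
def mixture (D t u : ℝ) : ℝ≥0∞ :=
  ENNReal.ofReal ((Real.exp (-t * u) - Real.exp (-t * D)) / (2 * t))

theorem measurable_mixture (D : ℝ) : Measurable fun p : ℝ × ℝ => mixture D p.1 p.2 := by
  unfold mixture
  fun_prop

/-- A Frullani integral: write (e^{-tu} - e^{-tD})/t as ∫_u^D e^{-ts} ds and apply Tonelli. For u ≥
D the truncation in `ENNReal.ofReal` makes both sides zero. -/
theorem lintegral_mixture_of_pos {u D : ℝ} (hu : 0 < u) (hD : 0 < D) :
    ∫⁻ t in Set.Ioi (0 : ℝ), mixture D t u = ENNReal.ofReal ((Real.log D - Real.log u) / 2) := by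
  rcases le_total u D with huD | huD
  · have e : ∀ t ∈ Set.Ioi (0 : ℝ), mixture D t u
        = ENNReal.ofReal 2⁻¹ * ∫⁻ s in Set.Ioc u D, ENNReal.ofReal (Real.exp (-t * s)) := by
      intro t ht
      rw [lintegral_exp_neg_mul_Ioc ht huD, ← ENNReal.ofReal_mul (by norm_num), mixture]
      congr 1
      have : t ≠ 0 := (Set.mem_Ioi.1 ht).ne'
      field_simp
    rw [setLIntegral_congr_fun measurableSet_Ioi e, lintegral_const_mul' _ _ ENNReal.ofReal_ne_top,
      lintegral_lintegral_swap (Measurable.aemeasurable (by fun_prop)),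
      setLIntegral_congr_fun measurableSet_Ioc
        fun s hs => lintegral_exp_neg_mul_Ioi (hu.trans hs.1),
      lintegral_inv_Ioc hu huD, ← ENNReal.ofReal_mul (by norm_num)]
    congr 1
    ring
  · rw [ENNReal.ofReal_of_nonpos (by have := Real.log_le_log hD huD; linarith)]
    rw [setLIntegral_congr_fun measurableSet_Ioi (g := fun _ => 0), lintegral_zero]
    intro t ht
    have ht' : 0 < t := ht
    refine ENNReal.ofReal_of_nonpos (div_nonpos_of_nonpos_of_nonneg ?_ (by positivity))
    rw [sub_nonpos, Real.exp_le_exp]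
    nlinarith

theorem lintegral_mixture_zero {D : ℝ} (hD : 0 < D) :
    ∫⁻ t in Set.Ioi (0 : ℝ), mixture D t 0 = ⊤ := by
  refine ENNReal.eq_top_of_forall_nnreal_le fun r => ?_
  -- For this u > 0 the integral is exactly r, and the integrand at 0 dominates the one at u.
  have h := lintegral_mixture_of_pos (Real.exp_pos (Real.log D - 2 * r)) hD
  rw [Real.log_exp, sub_sub_cancel, mul_div_cancel_left₀ _ (two_ne_zero' ℝ),
    ENNReal.ofReal_coe_nnreal] at h
  rw [← h]
  refine setLIntegral_mono' measurableSet_Ioi fun t ht => ENNReal.ofReal_le_ofReal ?_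
  have ht' : 0 < t := ht
  rw [mul_zero, Real.exp_zero]
  gcongr
  rw [Real.exp_le_one_iff]
  have := Real.exp_pos (Real.log D - 2 * r)
  nlinarith

theorem shiftKernel_logKernel_self (c : ℝ) (p : R3) : shiftKernel c logKernel p p = ⊤ := by
  simp [shiftKernel, logKernel]

theorem logKernel_of_ne {p q : R3} (h : p ≠ q) : logKernel p q = ((-Real.log (dist p q) : ℝ) : EReal) := by
  have h0 : 0 < dist p q := dist_pos.2 h
  rw [logKernel, edist_dist, one_div, ← ENNReal.ofReal_inv_of_pos h0,
    ENNReal.log_ofReal_of_pos (inv_pos.2 h0), Real.log_inv]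

theorem shiftKernel_logKernel_of_ne (c : ℝ) {p q : R3} (h : p ≠ q) :
    shiftKernel c logKernel p q = ENNReal.ofReal (c - Real.log (dist p q)) := by
  rw [shiftKernel, logKernel_of_ne h, ← EReal.coe_add, EReal.real_coe_toENNReal]
  congr 1
  ring

theorem shiftKernel_logKernel_eq_lintegral {R : ℝ} (hR : 0 < R) (p q : R3) :
    shiftKernel (Real.log R) logKernel p q
      = ∫⁻ t in Set.Ioi (0 : ℝ), mixture (R ^ 2) t (‖p - q‖ ^ 2) := by
  rcases eq_or_ne p q with rfl | h
  · simp [shiftKernel_logKernel_self, lintegral_mixture_zero (pow_pos hR 2)]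
  · have h0 : 0 < ‖p - q‖ := norm_sub_pos_iff.2 h
    rw [shiftKernel_logKernel_of_ne _ h, lintegral_mixture_of_pos (by positivity) (by positivity),
      Real.log_pow, Real.log_pow, dist_eq_norm]
    congr 1
    push_cast
    ring

/-! ### Strict positive definiteness of the logarithmic kernel -/

/-- The mutual shifted logarithmic energy of two measures. -/
def mutualEnergy (c : ℝ) (μ ν : Measure R3) : ℝ≥0∞ :=
  ∫⁻ p, shiftKernel c logKernel p.1 p.2 ∂(μ.prod ν)

theorem mutualEnergy_eq_lintegral {R : ℝ} (hR : 0 < R) (μ ν : Measure R3) [SFinite μ] [SFinite ν] :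
    mutualEnergy (Real.log R) μ ν
      = ∫⁻ t in Set.Ioi (0 : ℝ), ∫⁻ p, mixture (R ^ 2) t (‖p.1 - p.2‖ ^ 2) ∂(μ.prod ν) := by
  simp_rw [mutualEnergy, shiftKernel_logKernel_eq_lintegral hR]
  refine lintegral_lintegral_swap (Measurable.aemeasurable ?_)
  exact (measurable_mixture (R ^ 2)).comp (f := fun z : (R3 × R3) × ℝ =>
    (z.2, ‖z.1.1 - z.1.2‖ ^ 2)) (by fun_prop)

/-- Distances in B are at most R, so the truncation in `mixture` is inactive almost everywhere. The
sign is recorded because `ENNReal.ofReal` has to be undone later. -/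
theorem nonneg_and_lintegral_mixture_eq {R t : ℝ} (ht : 0 < t) {B : Set R3}
    (hB : ∀ p ∈ B, ∀ q ∈ B, dist p q ≤ R) {μ ν : Measure R3} (hμ : μ ∈ probOn B)
    (hν : ν ∈ probOn B) :
    0 ≤ (gaussianEnergy t μ ν - Real.exp (-t * R ^ 2)) / (2 * t) ∧
    ∫⁻ p, mixture (R ^ 2) t (‖p.1 - p.2‖ ^ 2) ∂(μ.prod ν)
      = ENNReal.ofReal ((gaussianEnergy t μ ν - Real.exp (-t * R ^ 2)) / (2 * t)) := by
  have := hμ.1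
  have := hν.1
  have hi : Integrable (fun p : R3 × R3 => Real.exp (-t * ‖p.1 - p.2‖ ^ 2)) (μ.prod ν) := by
    refine Integrable.of_bound (Continuous.aestronglyMeasurable (by fun_prop)) 1
      (Eventually.of_forall fun z => ?_)
    rw [Real.norm_of_nonneg (Real.exp_pos _).le, Real.exp_le_one_iff]
    have : 0 ≤ t * ‖z.1 - z.2‖ ^ 2 := by positivity
    linarith
  have hi' : Integrable (fun p : R3 × R3 =>
      (Real.exp (-t * ‖p.1 - p.2‖ ^ 2) - Real.exp (-t * R ^ 2)) / (2 * t)) (μ.prod ν) :=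
    (hi.sub (integrable_const _)).div_const _
  have h0 : 0 ≤ᵐ[μ.prod ν] fun p : R3 × R3 =>
      (Real.exp (-t * ‖p.1 - p.2‖ ^ 2) - Real.exp (-t * R ^ 2)) / (2 * t) := by
    filter_upwards [ae_prod_mem (show ∀ᵐ x ∂μ, x ∈ B from hμ.2) (show ∀ᵐ x ∂ν, x ∈ B from hν.2)]
      with p hp
    have hd := hB _ hp.1 _ hp.2
    rw [dist_eq_norm] at hd
    have : ‖p.1 - p.2‖ ^ 2 ≤ R ^ 2 := by gcongr
    refine div_nonneg (sub_nonneg.2 (Real.exp_le_exp.2 ?_)) (by positivity)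
    nlinarith
  have e : ∫ p, (Real.exp (-t * ‖p.1 - p.2‖ ^ 2) - Real.exp (-t * R ^ 2)) / (2 * t) ∂(μ.prod ν)
      = (gaussianEnergy t μ ν - Real.exp (-t * R ^ 2)) / (2 * t) := by
    rw [integral_div, integral_sub hi (integrable_const _), gaussianEnergy]
    simp
  rw [← e]
  exact ⟨integral_nonneg_of_ae h0, (ofReal_integral_eq_lintegral_ofReal hi' h0).symm⟩

theorem measurable_lintegral_mixture (D : ℝ) (μ ν : Measure R3) [SFinite μ] [SFinite ν] :
    Measurable fun t : ℝ => ∫⁻ p, mixture D t (‖p.1 - p.2‖ ^ 2) ∂(μ.prod ν) := by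
  refine Measurable.lintegral_prod_right' (f := fun z : ℝ × (R3 × R3) =>
    mixture D z.1 (‖z.2.1 - z.2.2‖ ^ 2)) ?_
  exact (measurable_mixture D).comp (f := fun z : ℝ × (R3 × R3) =>
    (z.1, ‖z.2.1 - z.2.2‖ ^ 2)) (by fun_prop)

theorem two_mul_ofReal (x : ℝ) : 2 * ENNReal.ofReal x = ENNReal.ofReal (2 * x) := by
  rw [ENNReal.ofReal_mul (by norm_num), ENNReal.ofReal_ofNat]

theorem two_mul_lintegral_mixture_le {R t : ℝ} (ht : 0 < t) {B : Set R3}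
    (hB : ∀ p ∈ B, ∀ q ∈ B, dist p q ≤ R) {μ ν : Measure R3} (hμ : μ ∈ probOn B)
    (hν : ν ∈ probOn B) :
    2 * ∫⁻ p, mixture (R ^ 2) t (‖p.1 - p.2‖ ^ 2) ∂(μ.prod ν)
      ≤ (∫⁻ p, mixture (R ^ 2) t (‖p.1 - p.2‖ ^ 2) ∂(μ.prod μ))
        + ∫⁻ p, mixture (R ^ 2) t (‖p.1 - p.2‖ ^ 2) ∂(ν.prod ν) := by
  have := hμ.1
  have := hν.1
  obtain ⟨h1, e1⟩ := nonneg_and_lintegral_mixture_eq ht hB hμ hν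
  obtain ⟨h2, e2⟩ := nonneg_and_lintegral_mixture_eq ht hB hμ hμ
  obtain ⟨h3, e3⟩ := nonneg_and_lintegral_mixture_eq ht hB hν hν
  rw [e1, e2, e3, ← ENNReal.ofReal_add h2 h3, two_mul_ofReal, ← mul_div_assoc, ← add_div]
  refine ENNReal.ofReal_le_ofReal (div_le_div_of_nonneg_right ?_ (by positivity))
  have := two_mul_gaussianEnergy_le ht μ ν
  linarith

theorem eq_of_two_mul_lintegral_mixture_eq {R t : ℝ} (ht : 0 < t) {B : Set R3}
    (hB : ∀ p ∈ B, ∀ q ∈ B, dist p q ≤ R) {μ ν : Measure R3} (hμ : μ ∈ probOn B)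
    (hν : ν ∈ probOn B)
    (h : 2 * ∫⁻ p, mixture (R ^ 2) t (‖p.1 - p.2‖ ^ 2) ∂(μ.prod ν)
      = (∫⁻ p, mixture (R ^ 2) t (‖p.1 - p.2‖ ^ 2) ∂(μ.prod μ))
        + ∫⁻ p, mixture (R ^ 2) t (‖p.1 - p.2‖ ^ 2) ∂(ν.prod ν)) : μ = ν := by
  have := hμ.1
  have := hν.1
  obtain ⟨h1, e1⟩ := nonneg_and_lintegral_mixture_eq ht hB hμ hν
  obtain ⟨h2, e2⟩ := nonneg_and_lintegral_mixture_eq ht hB hμ hμ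
  obtain ⟨h3, e3⟩ := nonneg_and_lintegral_mixture_eq ht hB hν hν
  rw [e1, e2, e3, ← ENNReal.ofReal_add h2 h3, two_mul_ofReal,
    ENNReal.ofReal_eq_ofReal_iff (by positivity) (by positivity)] at h
  refine eq_of_two_mul_gaussianEnergy_eq ht ?_
  field_simp at h
  linarith

/-- The Gaussian inequality holds for each t > 0. The integrals over t are finite and equal, so
equality holds for almost every t, and a single such t already forces μ = ν. -/
theorem eq_of_mutualEnergy_le {R : ℝ} (hR : 0 < R) {B : Set R3}
    (hB : ∀ p ∈ B, ∀ q ∈ B, dist p q ≤ R) {μ ν : Measure R3} (hμ : μ ∈ probOn B)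
    (hν : ν ∈ probOn B)
    (hfin : mutualEnergy (Real.log R) μ μ + mutualEnergy (Real.log R) ν ν ≠ ⊤)
    (h : mutualEnergy (Real.log R) μ μ + mutualEnergy (Real.log R) ν ν
      ≤ 2 * mutualEnergy (Real.log R) μ ν) : μ = ν := by
  have := hμ.1
  have := hν.1
  rw [mutualEnergy_eq_lintegral hR, mutualEnergy_eq_lintegral hR,
    ← lintegral_add_left (measurable_lintegral_mixture _ _ _)] at h hfin
  rw [mutualEnergy_eq_lintegral hR, ← lintegral_const_mul' _ _ (by simp)] at h
  have hle : ∀ᵐ t ∂(volume.restrict (Set.Ioi (0 : ℝ))),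
      2 * ∫⁻ p, mixture (R ^ 2) t (‖p.1 - p.2‖ ^ 2) ∂(μ.prod ν)
      ≤ (∫⁻ p, mixture (R ^ 2) t (‖p.1 - p.2‖ ^ 2) ∂(μ.prod μ))
        + ∫⁻ p, mixture (R ^ 2) t (‖p.1 - p.2‖ ^ 2) ∂(ν.prod ν) := by
    filter_upwards [ae_restrict_mem measurableSet_Ioi] with t ht
    exact two_mul_lintegral_mixture_le ht hB hμ hν
  have heq := ae_eq_of_ae_le_of_lintegral_le hle
    (ne_top_of_le_ne_top hfin (lintegral_mono_ae hle))
    ((measurable_lintegral_mixture _ _ _).add (measurable_lintegral_mixture _ _ _)).aemeasurable h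
  have : NeBot (ae (volume.restrict (Set.Ioi (0 : ℝ)))) := by
    rw [ae_neBot]
    simp
  obtain ⟨t, ht, he⟩ := (heq.and (ae_restrict_mem measurableSet_Ioi)).exists
  exact eq_of_two_mul_lintegral_mixture_eq he hB hμ hν ht

/-! ### Averaging the logarithmic kernel over rotations -/

theorem dist_sq_eq (p q : R3) :
    dist p q ^ 2 = (p 0 - q 0) ^ 2 + (p 1 - q 1) ^ 2 + (p 2 - q 2) ^ 2 := by
  rw [EuclideanSpace.dist_eq, Real.sq_sqrt (Finset.sum_nonneg fun i _ => sq_nonneg _),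
    Fin.sum_univ_three]
  simp [Real.dist_eq, sq_abs]

theorem complex_dist_sq_eq (z w : ℂ) : dist z w ^ 2 = (z.re - w.re) ^ 2 + (z.im - w.im) ^ 2 := by
  rw [Complex.dist_eq, ← Complex.normSq_eq_norm_sq, Complex.normSq_apply]
  simp
  ring

theorem profile_re_sq (p : R3) : (profile p).re ^ 2 = p 0 ^ 2 + p 2 ^ 2 :=
  Real.sq_sqrt (by positivity)

theorem profile_re_nonneg (p : R3) : 0 ≤ (profile p).re := Real.sqrt_nonneg _

/-- The mean of the distances of `z` from `w` and from its reflection. -/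
def meanDist (z w : ℂ) : ℝ := (dist z w + dist z (reflect w)) / 2

theorem meanDist_nonneg (z w : ℂ) : 0 ≤ meanDist z w := by
  unfold meanDist
  positivity

theorem meanDist_eq_zero_iff {z w : ℂ} : meanDist z w = 0 ↔ z = w ∧ z = reflect w := by
  have h1 : 0 ≤ dist z w := dist_nonneg
  have h2 : 0 ≤ dist z (reflect w) := dist_nonneg
  rw [← dist_eq_zero (x := z) (y := w), ← dist_eq_zero (x := z) (y := reflect w), meanDist]
  constructor
  · intro h
    constructor <;> linarith
  · rintro ⟨h, h'⟩
    rw [h, h']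
    norm_num

/-- The center `η` for which `|p - R_t q|` is a multiple of `|exp (i t) - η|`. -/
def rotationCenter (p q : R3) : ℂ :=
  ⟨(p 0 * q 0 + p 2 * q 2) / meanDist (profile p) (profile q) ^ 2,
    (p 2 * q 0 - p 0 * q 2) / meanDist (profile p) (profile q) ^ 2⟩

/-- With d = |z - w| and d_* = |z - w_*|, factor 4 Re z Re w = d_*² - d² and use d + d_* = 2m. -/
theorem re_mul_re_eq (z w : ℂ) :
    z.re * w.re = meanDist z w ^ 2 - meanDist z w * dist z w := by
  have h1 := complex_dist_sq_eq z w
  have h2 : dist z (reflect w) ^ 2 = (z.re - -w.re) ^ 2 + (z.im - w.im) ^ 2 :=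
    complex_dist_sq_eq z (reflect w)
  rw [meanDist]
  linear_combination (h1 - h2) / 4

theorem dist_rotation {p q : R3} (h : 0 < meanDist (profile p) (profile q)) (t : ℝ) :
    dist p (rotation t q) = meanDist (profile p) (profile q)
      * ‖circleMap 0 1 t - rotationCenter p q‖ := by
  have h1 := complex_dist_sq_eq (profile p) (profile q)
  have h3 := re_mul_re_eq (profile p) (profile q)
  have h4 := profile_re_sq p
  have h5 := profile_re_sq q
  have hm := h.ne'
  have e1 : (profile p).im = p 1 := rfl
  have e2 : (profile q).im = q 1 := rfl
  rw [e1, e2] at h1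
  have hη : ‖circleMap 0 1 t - rotationCenter p q‖ ^ 2
      = (Real.cos t - (rotationCenter p q).re) ^ 2 + (Real.sin t - (rotationCenter p q).im) ^ 2 := by
    rw [← Complex.normSq_eq_norm_sq, Complex.normSq_apply]
    simp [circleMap_zero, Complex.exp_ofReal_mul_I_re, Complex.exp_ofReal_mul_I_im]
    ring
  rw [← sq_eq_sq₀ dist_nonneg (by positivity), mul_pow, hη, dist_sq_eq]
  simp only [rotation, rotationCenter, PiLp.toLp_apply, Matrix.cons_val_zero, Matrix.cons_val_one,
    Matrix.cons_val]
  generalize meanDist (profile p) (profile q) = m at *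
  generalize dist (profile p) (profile q) = d at *
  generalize (profile p).re = x at *
  generalize (profile q).re = u at *
  -- Divided by m², this equates the terms of |p - R_t q|² and m²|e^{it} - η|² that are free of t,
  -- since |η| = xu/m².
  have key : m ^ 4 + (p 0 ^ 2 + p 2 ^ 2) * (q 0 ^ 2 + q 2 ^ 2)
      = m ^ 2 * (p 0 ^ 2 + p 2 ^ 2 + (q 0 ^ 2 + q 2 ^ 2) + (p 1 - q 1) ^ 2) := by
    rw [← h4, ← h5, ← mul_pow, h3]
    linear_combination m ^ 2 * h1 - 2 * m ^ 2 * h3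
  have hcs := Real.sin_sq_add_cos_sq t
  field_simp
  linear_combination (m ^ 2 * (q 0 ^ 2 + q 2 ^ 2) - m ^ 4) * hcs - key

/-- Here |η| = xu/m², and xu = m² - md ≤ m². -/
theorem norm_rotationCenter_le_one {p q : R3} (h : 0 < meanDist (profile p) (profile q)) :
    ‖rotationCenter p q‖ ≤ 1 := by
  have h3 := re_mul_re_eq (profile p) (profile q)
  have h4 := profile_re_sq p
  have h5 := profile_re_sq q
  have h6 := mul_nonneg (profile_re_nonneg p) (profile_re_nonneg q)
  have hd : 0 ≤ dist (profile p) (profile q) := dist_nonneg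
  rw [← sq_le_one_iff₀ (norm_nonneg _), ← Complex.normSq_eq_norm_sq, Complex.normSq_apply]
  simp only [rotationCenter]
  generalize meanDist (profile p) (profile q) = m at *
  generalize dist (profile p) (profile q) = d at *
  generalize (profile p).re = x at *
  generalize (profile q).re = u at *
  have hle : x * u ≤ m ^ 2 := by nlinarith [mul_nonneg h.le hd]
  have e : (p 0 * q 0 + p 2 * q 2) / m ^ 2 * ((p 0 * q 0 + p 2 * q 2) / m ^ 2)
      + (p 2 * q 0 - p 0 * q 2) / m ^ 2 * ((p 2 * q 0 - p 0 * q 2) / m ^ 2)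
      = (x * u / m ^ 2) ^ 2 := by
    rw [div_pow, mul_pow, h4, h5]
    field_simp
    ring
  rw [e, sq_le_one_iff₀ (by positivity)]
  exact div_le_one_of_le₀ hle (by positivity)

theorem shiftKernel_reducedKernel_of_pos (c : ℝ) {z w : ℂ} (h : 0 < meanDist z w) :
    shiftKernel c reducedKernel z w = ENNReal.ofReal (c - Real.log (meanDist z w)) := by
  have e : 2 / (edist z w + edist z (reflect w)) = ENNReal.ofReal (meanDist z w)⁻¹ := by
    rw [edist_dist, edist_dist, ← ENNReal.ofReal_add dist_nonneg dist_nonneg,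
      ← ENNReal.ofReal_ofNat 2, ← ENNReal.ofReal_div_of_pos, meanDist, inv_div]
    have := h
    unfold meanDist at this
    linarith
  rw [shiftKernel, reducedKernel, e, ENNReal.log_ofReal_of_pos (inv_pos.2 h), Real.log_inv,
    ← EReal.coe_add, EReal.real_coe_toENNReal]
  congr 1
  ring

theorem shiftKernel_reducedKernel_of_eq_zero (c : ℝ) {z w : ℂ} (h : meanDist z w = 0) :
    shiftKernel c reducedKernel z w = ⊤ := by
  obtain ⟨h1, h2⟩ := meanDist_eq_zero_iff.1 h
  rw [← h1] at h2
  simp [shiftKernel, reducedKernel, ← h1, ← h2, ENNReal.div_zero]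

/-- The uniform probability measure on the interval of angles. -/
def angleMeasure : Measure ℝ :=
  ENNReal.ofReal (2 * Real.pi)⁻¹ • volume.restrict (Set.Ioc 0 (2 * Real.pi))

instance : IsProbabilityMeasure angleMeasure := by
  refine ⟨?_⟩
  simp only [angleMeasure, Measure.smul_apply, Measure.restrict_apply_univ, Real.volume_Ioc,
    sub_zero, smul_eq_mul]
  rw [← ENNReal.ofReal_mul (by positivity), inv_mul_cancel₀ (by positivity), ENNReal.ofReal_one]

theorem lintegral_shiftKernel_rotation {c : ℝ} {p q : R3}
    (hb : ∀ t, dist p (rotation t q) ≤ Real.exp c) :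
    ∫⁻ t, shiftKernel c logKernel p (rotation t q) ∂angleMeasure
      = shiftKernel c reducedKernel (profile p) (profile q) := by
  rcases (meanDist_nonneg (profile p) (profile q)).eq_or_lt with h | h
  -- Both points coincide on the axis, every rotation fixes them, and both sides are infinite.
  · rw [shiftKernel_reducedKernel_of_eq_zero c h.symm]
    obtain ⟨h1, h2⟩ := meanDist_eq_zero_iff.1 h.symm
    have hre : (profile q).re = 0 := by
      have e1 := congrArg Complex.re h1
      have e2 := congrArg Complex.re h2
      simp only [reflect] at e2
      linarith
    have hq := profile_re_sq q
    have hp := profile_re_sq p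
    rw [h1, hre] at hp
    rw [hre] at hq
    have e0 : p 0 = 0 := by nlinarith [sq_nonneg (p 0), sq_nonneg (p 2)]
    have e1 : p 2 = 0 := by nlinarith [sq_nonneg (p 0), sq_nonneg (p 2)]
    have e2 : q 0 = 0 := by nlinarith [sq_nonneg (q 0), sq_nonneg (q 2)]
    have e3 : q 2 = 0 := by nlinarith [sq_nonneg (q 0), sq_nonneg (q 2)]
    have e4 : p 1 = q 1 := congrArg Complex.im h1
    have e (t : ℝ) : rotation t q = p := by
      ext i
      fin_cases i <;> simp [rotation, e0, e1, e2, e3, e4]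
    simp [e, shiftKernel_logKernel_self]
  · rw [shiftKernel_reducedKernel_of_pos c h]
    set m := meanDist (profile p) (profile q) with hm
    set η := rotationCenter p q with hη
    have hne : ∀ᵐ t ∂(volume.restrict (Set.Ioc 0 (2 * Real.pi))), circleMap 0 1 t ≠ η := by
      refine ae_restrict_of_ae ?_
      have := ((Set.countable_singleton η).preimage_circleMap 0 one_ne_zero).measure_zero volume
      rw [ae_iff]
      convert this using 2
      ext t
      simp
    have hdist (t : ℝ) : dist p (rotation t q) = m * ‖circleMap 0 1 t - η‖ := dist_rotation h t
    have hpos {t : ℝ} (ht : circleMap 0 1 t ≠ η) : 0 < ‖circleMap 0 1 t - η‖ :=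
      norm_sub_pos_iff.2 ht
    have hlog {t : ℝ} (ht : circleMap 0 1 t ≠ η) : Real.log (dist p (rotation t q))
        = Real.log m + Real.log ‖circleMap 0 1 t - η‖ := by
      rw [hdist, Real.log_mul h.ne' (hpos ht).ne']
    have hint : CircleIntegrable (fun z => Real.log ‖z - η‖) 0 1 :=
      circleIntegrable_log_norm_sub_const 1
    have hint' : Integrable (fun t => c - Real.log m - Real.log ‖circleMap 0 1 t - η‖)
        (volume.restrict (Set.Ioc 0 (2 * Real.pi))) :=
      (integrable_const _).sub hint.1
    -- Jensen's formula: the circle average is log⁺ |η|, which vanishes as |η| ≤ 1, including the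
    -- case |η| = 1.
    have havg : ∫ t in Set.Ioc 0 (2 * Real.pi), Real.log ‖circleMap 0 1 t - η‖ = 0 := by
      have h0 := circleAverage_log_norm_sub_const_eq_posLog (a := η)
      rw [Real.posLog_eq_zero_iff _ |>.2 (by
        rw [abs_of_nonneg (norm_nonneg _)]
        exact norm_rotationCenter_le_one h), Real.circleAverage_def, smul_eq_mul,
        intervalIntegral.integral_of_le (by positivity)] at h0
      exact (mul_eq_zero.1 h0).resolve_left (by positivity)
    rw [angleMeasure, lintegral_smul_measure, smul_eq_mul]
    have e : ∫⁻ t in Set.Ioc 0 (2 * Real.pi), shiftKernel c logKernel p (rotation t q)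
        = ∫⁻ t in Set.Ioc 0 (2 * Real.pi),
          ENNReal.ofReal (c - Real.log m - Real.log ‖circleMap 0 1 t - η‖) := by
      refine lintegral_congr_ae ?_
      filter_upwards [hne] with t ht
      have : p ≠ rotation t q := by
        rw [← dist_pos, hdist]
        exact mul_pos h (hpos ht)
      rw [shiftKernel_logKernel_of_ne _ this, hlog ht, sub_sub]
    rw [e, ← ofReal_integral_eq_lintegral_ofReal hint', ← ENNReal.ofReal_mul (by positivity),
      integral_sub (integrable_const _) hint.1, havg, integral_const]
    · congr 1
      rw [measureReal_restrict_apply_univ, Real.volume_real_Ioc_of_le (by positivity), sub_zero,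
        smul_eq_mul, sub_zero, inv_mul_cancel_left₀ (by positivity)]
    -- The bound `hb` makes the integrand nonnegative, so truncation at zero loses nothing.
    · filter_upwards [hne] with t ht
      have h1 := hlog ht
      have h2 : 0 < dist p (rotation t q) := by
        rw [hdist]
        exact mul_pos h (hpos ht)
      have h3 := Real.log_le_log h2 (hb t)
      rw [Real.log_exp] at h3
      simp only [Pi.zero_apply]
      linarith

/-! ### Regularity and lower bounds -/

theorem continuous_profile : Continuous profile := by
  have : profile = fun p : R3 =>
      Complex.equivRealProdCLM.symm (Real.sqrt (p 0 ^ 2 + p 2 ^ 2), p 1) := by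
    funext p
    apply Complex.ext <;> simp [profile]
  rw [this]
  fun_prop

theorem norm_profile (p : R3) : ‖profile p‖ = ‖p‖ := by
  rw [← sq_eq_sq₀ (norm_nonneg _) (norm_nonneg _), ← Complex.normSq_eq_norm_sq,
    Complex.normSq_apply, ← sq, profile_re_sq, EuclideanSpace.norm_sq_eq, Fin.sum_univ_three]
  simp [profile]
  ring

theorem continuous_rotation : Continuous fun z : ℝ × R3 => rotation z.1 z.2 := by
  refine (PiLp.continuous_toLp 2 _).comp (continuous_pi fun i => ?_)
  fin_cases i <;> simp <;> fun_prop

theorem measurable_rotation (t : ℝ) : Measurable (rotation t) :=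
  (continuous_rotation.comp (by fun_prop : Continuous fun p : R3 => (t, p))).measurable

theorem dist_rotation_rotation (t : ℝ) (p q : R3) :
    dist (rotation t p) (rotation t q) = dist p q := by
  rw [← sq_eq_sq₀ dist_nonneg dist_nonneg, dist_sq_eq, dist_sq_eq]
  simp only [rotation, PiLp.toLp_apply, Matrix.cons_val_zero, Matrix.cons_val_one,
    Matrix.cons_val]
  linear_combination ((p 0 - q 0) ^ 2 + (p 2 - q 2) ^ 2) * Real.sin_sq_add_cos_sq t

theorem profile_rotation (t : ℝ) (p : R3) : profile (rotation t p) = profile p := by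
  have e : (p 0 * Real.cos t - p 2 * Real.sin t) ^ 2 + (p 0 * Real.sin t + p 2 * Real.cos t) ^ 2
      = p 0 ^ 2 + p 2 ^ 2 := by
    linear_combination (p 0 ^ 2 + p 2 ^ 2) * Real.sin_sq_add_cos_sq t
  simp [profile, rotation, e]

/-- The embedding of the half-plane in three-space. -/
def embed (z : ℂ) : R3 := !₂[z.re, z.im, 0]

theorem continuous_embed : Continuous embed := by
  refine (PiLp.continuous_toLp 2 _).comp (continuous_pi fun i => ?_)
  fin_cases i <;> simp <;> fun_prop

theorem profile_embed {z : ℂ} (hz : z ∈ rightHalfPlane) : profile (embed z) = z := by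
  have h : 0 ≤ z.re := hz
  apply Complex.ext <;> simp [profile, embed, Real.sqrt_sq h]

theorem isCompact_revolution {A : Set ℂ} (hA : IsCompact A) (hAH : A ⊆ rightHalfPlane) :
    IsCompact (revolution A) := by
  rw [revolution_eq_preimage hAH]
  obtain ⟨M, hM⟩ := hA.isBounded.exists_norm_le
  refine Metric.isCompact_of_isClosed_isBounded (hA.isClosed.preimage continuous_profile)
    (isBounded_iff_forall_norm_le.2 ⟨M, fun p hp => ?_⟩)
  rw [← norm_profile]
  exact hM _ hp

theorem continuous_logKernel : Continuous fun p : R3 × R3 => logKernel p.1 p.2 := by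
  simp only [logKernel, one_div]
  exact ENNReal.continuous_log.comp (continuous_inv.comp (by fun_prop))

theorem continuous_shiftKernel_logKernel (c : ℝ) :
    Continuous fun p : R3 × R3 => shiftKernel c logKernel p.1 p.2 := by
  refine EReal.continuous_toENNReal.comp (continuous_iff_continuousAt.2 fun p => ?_)
  exact (EReal.continuousAt_add (p := (logKernel p.1 p.2, (c : EReal))) (Or.inr (by simp))
    (Or.inr (by simp))).comp (f := fun p : R3 × R3 => (logKernel p.1 p.2, (c : EReal)))
    (continuous_logKernel.prodMk continuous_const).continuousAt

theorem measurable_shiftKernel_logKernel (c : ℝ) :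
    Measurable fun p : R3 × R3 => shiftKernel c logKernel p.1 p.2 :=
  (continuous_shiftKernel_logKernel c).measurable

theorem measurable_reducedKernel : Measurable fun p : ℂ × ℂ => reducedKernel p.1 p.2 := by
  have hr : Continuous reflect := by
    have : reflect = fun w : ℂ => Complex.equivRealProdCLM.symm (-w.re, w.im) := by
      funext w
      apply Complex.ext <;> simp [reflect]
    rw [this]
    fun_prop
  refine ENNReal.measurable_log.comp (measurable_const.div (Continuous.measurable ?_))
  exact (continuous_fst.edist continuous_snd).add
    (continuous_fst.edist (hr.comp continuous_snd))

theorem measurable_shiftKernel_reducedKernel (c : ℝ) :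
    Measurable fun p : ℂ × ℂ => shiftKernel c reducedKernel p.1 p.2 :=
  measurable_ereal_toENNReal.comp (measurable_reducedKernel.add_const _)

theorem neg_le_logKernel {c : ℝ} {p q : R3} (h : dist p q ≤ Real.exp c) :
    ((-c : ℝ) : EReal) ≤ logKernel p q := by
  rcases eq_or_ne p q with rfl | hpq
  · simp [logKernel]
  · rw [logKernel_of_ne hpq, EReal.coe_le_coe_iff, neg_le_neg_iff]
    exact (Real.log_le_iff_le_exp (dist_pos.2 hpq)).2 h

theorem norm_reflect (w : ℂ) : ‖reflect w‖ = ‖w‖ := by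
  rw [← sq_eq_sq₀ (norm_nonneg _) (norm_nonneg _), ← Complex.normSq_eq_norm_sq,
    ← Complex.normSq_eq_norm_sq, Complex.normSq_apply, Complex.normSq_apply]
  simp [reflect]

theorem neg_le_reducedKernel {c : ℝ} {z w : ℂ} (h1 : dist z w ≤ Real.exp c)
    (h2 : dist z (reflect w) ≤ Real.exp c) : ((-c : ℝ) : EReal) ≤ reducedKernel z w := by
  have h : edist z w + edist z (reflect w) ≤ 2 * ENNReal.ofReal (Real.exp c) := by
    rw [two_mul, edist_dist, edist_dist]
    gcongr
  have h3 : ENNReal.ofReal (Real.exp (-c)) ≤ 2 / (edist z w + edist z (reflect w)) := by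
    refine le_trans ?_ (ENNReal.div_le_div_left h 2)
    rw [Real.exp_neg, ENNReal.ofReal_inv_of_pos (Real.exp_pos c), ENNReal.div_eq_inv_mul,
      ENNReal.mul_inv (by simp) (by simp), mul_right_comm, ENNReal.inv_mul_cancel (by simp) (by simp),
      one_mul]
  have h4 := ENNReal.log_monotone h3
  rwa [ENNReal.log_ofReal_of_pos (Real.exp_pos _), Real.log_exp] at h4

/-! ### Uniqueness of the logarithmic equilibrium measure -/

theorem mutualEnergy_comm (c : ℝ) (μ ν : Measure R3) [SFinite μ] [SFinite ν] :
    mutualEnergy c μ ν = mutualEnergy c ν μ := by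
  rw [mutualEnergy, mutualEnergy, ← Measure.prod_swap,
    lintegral_map (measurable_shiftKernel_logKernel c) measurable_swap]
  refine lintegral_congr fun p => ?_
  simp [shiftKernel, logKernel, edist_comm]

theorem mutualEnergy_add_left (c : ℝ) (μ μ' ν : Measure R3) [SFinite μ] [SFinite μ'] [SFinite ν] :
    mutualEnergy c (μ + μ') ν = mutualEnergy c μ ν + mutualEnergy c μ' ν := by
  rw [mutualEnergy, Measure.add_prod, lintegral_add_measure, mutualEnergy, mutualEnergy]

theorem mutualEnergy_smul_left (c : ℝ) (a : ℝ≥0∞) (μ ν : Measure R3) [SFinite ν] :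
    mutualEnergy c (a • μ) ν = a * mutualEnergy c μ ν := by
  rw [mutualEnergy, Measure.prod_smul_left, lintegral_smul_measure, mutualEnergy, smul_eq_mul]

theorem midpoint_mem_probOn {X : Type*} [MeasurableSpace X] {B : Set X} {μ ν : Measure X}
    (hμ : μ ∈ probOn B) (hν : ν ∈ probOn B) : (2⁻¹ : ℝ≥0∞) • (μ + ν) ∈ probOn B := by
  have := hμ.1
  have := hν.1
  refine ⟨⟨?_⟩, ?_⟩
  · simp [ENNReal.inv_two_add_inv_two]
  · simp [hμ.2, hν.2]

/-- Let V be the minimal energy and M the mutual energy. Testing minimality on the midpoint gives V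
≤ (2V + 2M)/4, so V ≤ M, the reverse of the strict inequality that positive definiteness gives for μ
≠ ν. -/
theorem eq_of_shiftEnergy_minimal {c : ℝ} {B : Set R3}
    (hB : ∀ p ∈ B, ∀ q ∈ B, dist p q ≤ Real.exp c) {μ ν : Measure R3} (hμ : μ ∈ probOn B)
    (hν : ν ∈ probOn B) (hfin : shiftEnergy c logKernel μ ≠ ⊤)
    (hμmin : ∀ ρ ∈ probOn B, shiftEnergy c logKernel μ ≤ shiftEnergy c logKernel ρ)
    (hνmin : ∀ ρ ∈ probOn B, shiftEnergy c logKernel ν ≤ shiftEnergy c logKernel ρ) :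
    μ = ν := by
  have := hμ.1
  have := hν.1
  have e (ρ : Measure R3) : shiftEnergy c logKernel ρ = mutualEnergy c ρ ρ := rfl
  have hm := midpoint_mem_probOn hμ hν
  have := hm.1
  have h := hμmin _ hm
  have hνμ : mutualEnergy c ν ν = mutualEnergy c μ μ := le_antisymm (hνmin _ hμ) (hμmin _ hν)
  have hl (ρ : Measure R3) [SFinite ρ] : mutualEnergy c ((2⁻¹ : ℝ≥0∞) • (μ + ν)) ρ
      = 2⁻¹ * (mutualEnergy c μ ρ + mutualEnergy c ν ρ) := by
    rw [mutualEnergy_smul_left, mutualEnergy_add_left]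
  rw [e, e, hl, mutualEnergy_comm c μ (_ • _), mutualEnergy_comm c ν (_ • _), hl, hl,
    mutualEnergy_comm c ν μ, hνμ, mul_add 2⁻¹ (_ * _)] at h
  have hV : mutualEnergy c μ μ ≠ ⊤ := hfin
  have key : mutualEnergy c μ μ ≤ mutualEnergy c μ ν := by
    by_cases hM : mutualEnergy c μ ν = ⊤
    · simp [hM]
    generalize mutualEnergy c μ μ = V at h hV
    generalize mutualEnergy c μ ν = M at h hM
    lift V to ℝ≥0 using hV
    lift M to ℝ≥0 using hM
    have h2 : (2⁻¹ : ℝ≥0∞) = ((2⁻¹ : ℝ≥0) : ℝ≥0∞) := by simp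
    rw [h2] at h
    norm_cast at h ⊢
    have h' : (V : ℝ) ≤ 2⁻¹ * (2⁻¹ * (V + M)) + 2⁻¹ * (2⁻¹ * (M + V)) := by exact_mod_cast h
    rw [← NNReal.coe_le_coe]
    linarith
  refine eq_of_mutualEnergy_le (Real.exp_pos c) hB hμ hν ?_ ?_
  · rw [Real.log_exp, hνμ]
    exact ENNReal.add_ne_top.2 ⟨hV, hV⟩
  · rw [Real.log_exp, hνμ, ← two_mul]
    gcongr

/-! ### Projecting invariant measures -/

theorem map_rotation_mem_probOn {A : Set ℂ} (hA : MeasurableSet A) (hAH : A ⊆ rightHalfPlane)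
    (t : ℝ) {μ : Measure R3} (hμ : μ ∈ probOn (revolution A)) :
    μ.map (rotation t) ∈ probOn (revolution A) := by
  have := hμ.1
  refine ⟨Measure.isProbabilityMeasure_map (measurable_rotation t).aemeasurable, ?_⟩
  have h := hμ.2
  rw [revolution_eq_preimage hAH] at h ⊢
  rw [Measure.map_apply (measurable_rotation t) (measurable_profile hA).compl]
  convert h using 2
  ext p
  simp [profile_rotation]

theorem shiftEnergy_map_rotation (c t : ℝ) (μ : Measure R3) [IsProbabilityMeasure μ] :
    shiftEnergy c logKernel (μ.map (rotation t)) = shiftEnergy c logKernel μ := by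
  rw [shiftEnergy, Measure.map_prod_map _ _ (measurable_rotation t) (measurable_rotation t),
    lintegral_map (measurable_shiftKernel_logKernel c)
      ((measurable_rotation t).prodMap (measurable_rotation t)), shiftEnergy]
  refine lintegral_congr fun p => ?_
  simp [shiftKernel, logKernel, edist_dist, dist_rotation_rotation]

theorem reducedMeasure_mem_probOn {A : Set ℂ} (hA : MeasurableSet A) (hAH : A ⊆ rightHalfPlane)
    {μ : Measure R3} (hμ : μ ∈ probOn (revolution A)) : reducedMeasure μ ∈ probOn A := by
  have := hμ.1
  refine ⟨Measure.isProbabilityMeasure_map measurable_profile.aemeasurable, ?_⟩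
  have h := hμ.2
  rw [revolution_eq_preimage hAH] at h
  rwa [reducedMeasure, Measure.map_apply measurable_profile hA.compl]

theorem rotation_mem_revolution {A : Set ℂ} (hAH : A ⊆ rightHalfPlane) {p : R3}
    (hp : p ∈ revolution A) (t : ℝ) : rotation t p ∈ revolution A := by
  rw [revolution_eq_preimage hAH] at hp ⊢
  simpa [profile_rotation] using hp

theorem shiftEnergy_reducedMeasure {c : ℝ} {A : Set ℂ} (hAH : A ⊆ rightHalfPlane)
    (hc : ∀ p ∈ revolution A, ∀ q ∈ revolution A, dist p q ≤ Real.exp c) {μ : Measure R3}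
    (hμ : μ ∈ probOn (revolution A)) (hinv : ∀ t, μ.map (rotation t) = μ) :
    shiftEnergy c reducedKernel (reducedMeasure μ) = shiftEnergy c logKernel μ := by
  have := hμ.1
  have hμ' : ∀ᵐ p ∂μ, p ∈ revolution A := hμ.2
  rw [shiftEnergy, reducedMeasure,
    Measure.map_prod_map _ _ measurable_profile measurable_profile,
    lintegral_map (measurable_shiftKernel_reducedKernel c)
      (measurable_profile.prodMap measurable_profile)]
  have e : ∫⁻ p, shiftKernel c reducedKernel (Prod.map profile profile p).1
        (Prod.map profile profile p).2 ∂(μ.prod μ)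
      = ∫⁻ p, ∫⁻ t, shiftKernel c logKernel p.1 (rotation t p.2) ∂angleMeasure ∂(μ.prod μ) := by
    refine lintegral_congr_ae ?_
    filter_upwards [ae_prod_mem hμ' hμ'] with p hp
    exact (lintegral_shiftKernel_rotation fun t =>
      hc _ hp.1 _ (rotation_mem_revolution hAH hp.2 t)).symm
  have hmeas : Measurable fun z : (R3 × R3) × ℝ =>
      shiftKernel c logKernel z.1.1 (rotation z.2 z.1.2) := by
    refine (measurable_shiftKernel_logKernel c).comp (f := fun z : (R3 × R3) × ℝ =>
      (z.1.1, rotation z.2 z.1.2)) (measurable_fst.fst.prodMk ?_)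
    exact continuous_rotation.measurable.comp (measurable_snd.prodMk measurable_fst.snd)
  -- Only the second factor is rotated; id × R_t preserves μ × μ because μ is invariant.
  have e2 (t : ℝ) : ∫⁻ p, shiftKernel c logKernel p.1 (rotation t p.2) ∂(μ.prod μ)
      = shiftEnergy c logKernel μ := by
    have h := Measure.map_prod_map μ μ measurable_id (measurable_rotation t)
    rw [hinv, Measure.map_id] at h
    rw [shiftEnergy]
    conv_rhs => rw [h]
    rw [lintegral_map (measurable_shiftKernel_logKernel c)
      (measurable_id.prodMap (measurable_rotation t))]
    rfl
  rw [e, lintegral_lintegral_swap hmeas.aemeasurable]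
  simp [e2]

/-! ### Lifting measures from the half-plane -/

/-- The parametrization of three-space by a point of the half-plane and an angle. -/
def revolve (x : ℂ × ℝ) : R3 := rotation x.2 (embed x.1)

theorem measurable_revolve : Measurable revolve :=
  (continuous_rotation.comp (continuous_snd.prodMk (continuous_embed.comp continuous_fst))).measurable

theorem profile_revolve {x : ℂ × ℝ} (hx : x.1 ∈ rightHalfPlane) : profile (revolve x) = x.1 := by
  rw [revolve, profile_rotation, profile_embed hx]

/-- The rotation-invariant measure on three-space which projects to `ν`. -/
def liftMeasure (ν : Measure ℂ) : Measure R3 := (ν.prod angleMeasure).map revolve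

theorem ae_mem_fst {A : Set ℂ} {ν : Measure ℂ} (hν : ν ∈ probOn A) :
    ∀ᵐ x ∂(ν.prod angleMeasure), x.1 ∈ A :=
  Measure.quasiMeasurePreserving_fst.ae (show ∀ᵐ z ∂ν, z ∈ A from hν.2)

theorem reducedMeasure_liftMeasure {A : Set ℂ} (hAH : A ⊆ rightHalfPlane) {ν : Measure ℂ}
    (hν : ν ∈ probOn A) : reducedMeasure (liftMeasure ν) = ν := by
  have := hν.1
  rw [reducedMeasure, liftMeasure, Measure.map_map measurable_profile measurable_revolve]
  have : profile ∘ revolve =ᵐ[ν.prod angleMeasure] Prod.fst := by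
    filter_upwards [ae_mem_fst hν] with x hx using profile_revolve (hAH hx)
  rw [Measure.map_congr this, Measure.map_fst_prod, measure_univ, one_smul]

theorem liftMeasure_mem_probOn {A : Set ℂ} (hA : MeasurableSet A) (hAH : A ⊆ rightHalfPlane)
    {ν : Measure ℂ} (hν : ν ∈ probOn A) : liftMeasure ν ∈ probOn (revolution A) := by
  have := hν.1
  refine ⟨Measure.isProbabilityMeasure_map measurable_revolve.aemeasurable, ?_⟩
  rw [revolution_eq_preimage hAH, ← Set.preimage_compl, ← Measure.map_apply measurable_profile
    hA.compl]
  change reducedMeasure (liftMeasure ν) Aᶜ = 0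
  rw [reducedMeasure_liftMeasure hAH hν]
  exact hν.2

/-- With the first point and its angle fixed, averaging over the second angle already produces the
reduced kernel; the first angle then integrates out with mass one. -/
theorem shiftEnergy_liftMeasure {c : ℝ} {A : Set ℂ} (hAH : A ⊆ rightHalfPlane)
    (hc : ∀ p ∈ revolution A, ∀ q ∈ revolution A, dist p q ≤ Real.exp c) {ν : Measure ℂ}
    (hν : ν ∈ probOn A) :
    shiftEnergy c logKernel (liftMeasure ν) = shiftEnergy c reducedKernel ν := by
  have := hν.1
  have hν' : ∀ᵐ z ∂ν, z ∈ A := hν.2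
  have hK := measurable_shiftKernel_logKernel c
  have hK' := measurable_shiftKernel_reducedKernel c
  have hmem {x : ℂ × ℝ} (hx : x.1 ∈ A) : revolve x ∈ revolution A := by
    rw [revolution_eq_preimage hAH, Set.mem_preimage, profile_revolve (hAH hx)]
    exact hx
  have hmeas : Measurable fun p : (ℂ × ℝ) × (ℂ × ℝ) => shiftKernel c logKernel
      (Prod.map revolve revolve p).1 (Prod.map revolve revolve p).2 :=
    hK.comp (measurable_revolve.prodMap measurable_revolve)
  rw [shiftEnergy, liftMeasure, Measure.map_prod_map _ _ measurable_revolve measurable_revolve,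
    lintegral_map hK (measurable_revolve.prodMap measurable_revolve),
    lintegral_prod _ hmeas.aemeasurable]
  have e : ∀ᵐ x ∂(ν.prod angleMeasure), ∫⁻ y, shiftKernel c logKernel
      (Prod.map revolve revolve (x, y)).1 (Prod.map revolve revolve (x, y)).2
        ∂(ν.prod angleMeasure)
      = ∫⁻ w, shiftKernel c reducedKernel x.1 w ∂ν := by
    filter_upwards [ae_mem_fst hν] with x hx
    simp only [Prod.map_fst, Prod.map_snd]
    have hx' : Measurable fun y => shiftKernel c logKernel (revolve x) (revolve y) :=
      hK.comp (f := fun y => (revolve x, revolve y)) (measurable_const.prodMk measurable_revolve)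
    rw [lintegral_prod _ hx'.aemeasurable]
    refine lintegral_congr_ae ?_
    filter_upwards [hν'] with w hw
    have h := lintegral_shiftKernel_rotation (c := c) (p := revolve x) (q := embed w) fun t =>
      hc _ (hmem hx) _ (hmem (x := (w, t)) hw)
    rw [profile_revolve (hAH hx), profile_embed (hAH hw)] at h
    exact h
  have hmeas' : Measurable fun x : ℂ × ℝ => ∫⁻ w, shiftKernel c reducedKernel x.1 w ∂ν :=
    hK'.lintegral_prod_right'.comp measurable_fst
  rw [lintegral_congr_ae e, lintegral_prod _ hmeas'.aemeasurable, shiftEnergy,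
    lintegral_prod _ hK'.aemeasurable]
  simp

/-! ### Common shift and conclusion -/

/-- `profile` and `reflect` preserve norms, so twice a norm bound for A controls every distance in
both kernels. The maximum with 1 ensures c ≥ 0. -/
theorem exists_shift {A : Set ℂ} (hA : IsCompact A) (hAH : A ⊆ rightHalfPlane) :
    ∃ c : ℝ, 0 ≤ c ∧ (∀ p ∈ revolution A, ∀ q ∈ revolution A, dist p q ≤ Real.exp c) ∧
      ∀ z ∈ A, ∀ w ∈ A, ((-c : ℝ) : EReal) ≤ reducedKernel z w := by
  obtain ⟨M, hM⟩ := hA.isBounded.exists_norm_le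
  have hR : 0 < max 1 (2 * M) := by positivity
  have hd {E : Type} [NormedAddCommGroup E] {x y : E} (hx : ‖x‖ ≤ M) (hy : ‖y‖ ≤ M) :
      dist x y ≤ Real.exp (Real.log (max 1 (2 * M))) := by
    rw [Real.exp_log hR]
    refine (dist_le_norm_add_norm x y).trans (le_trans ?_ (le_max_right _ _))
    linarith
  refine ⟨Real.log (max 1 (2 * M)), Real.log_nonneg (le_max_left _ _), fun p hp q hq => ?_,
    fun z hz w hw => neg_le_reducedKernel (hd (hM z hz) (hM w hw))
      (hd (hM z hz) ((norm_reflect w).trans_le (hM w hw)))⟩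
  rw [revolution_eq_preimage hAH] at hp hq
  exact hd ((norm_profile p).symm.trans_le (hM _ hp)) ((norm_profile q).symm.trans_le (hM _ hq))

theorem exists_shiftEnergy_ne_top {c : ℝ} (hc0 : 0 ≤ c) {A : Set ℂ} (hnd : NonDegenerate A)
    (hc : ∀ p ∈ revolution A, ∀ q ∈ revolution A, dist p q ≤ Real.exp c) :
    ∃ μ ∈ probOn (revolution A), shiftEnergy c logKernel μ ≠ ⊤ := by
  rw [NonDegenerate, logCapacity, EReal.zero_lt_exp_iff, bot_lt_iff_ne_bot, Ne,
    EReal.neg_eq_bot_iff, ← Ne, ← lt_top_iff_ne_top] at hnd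
  simp only [iInf_lt_iff] at hnd
  obtain ⟨μ, hμ, h⟩ := hnd
  refine ⟨μ, hμ, fun htop => h.ne ?_⟩
  rw [energy_eq_shiftEnergy_sub continuous_logKernel.measurable hc0
    (fun p hp q hq => neg_le_logKernel (hc p hp q hq)) hμ, htop]
  simp

end RevolutionEnergy

end

theorem mainTheorem8 (A : Set ℂ) (hA : IsCompact A) (hAH : A ⊆ RevolutionEnergy.rightHalfPlane)
    (hnd : RevolutionEnergy.NonDegenerate A) :
    (∃! μ : MeasureTheory.Measure RevolutionEnergy.R3,
      RevolutionEnergy.IsEnergyMinimizer RevolutionEnergy.logKernel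
        (RevolutionEnergy.revolution A) μ) ∧
    ∀ μ : MeasureTheory.Measure RevolutionEnergy.R3,
      RevolutionEnergy.IsEnergyMinimizer RevolutionEnergy.logKernel
        (RevolutionEnergy.revolution A) μ →
      RevolutionEnergy.IsEnergyMinimizer RevolutionEnergy.reducedKernel A
        (RevolutionEnergy.reducedMeasure μ) ∧
      ∀ ν : MeasureTheory.Measure ℂ,
        RevolutionEnergy.IsEnergyMinimizer RevolutionEnergy.reducedKernel A ν →
        ν = RevolutionEnergy.reducedMeasure μ := by
  open RevolutionEnergy in
  obtain ⟨c, hc0, hc, hcr⟩ := exists_shift hA hAH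
  obtain ⟨μ₀, hμ₀, hfin₀⟩ := exists_shiftEnergy_ne_top hc0 hnd hc
  have hmA := hA.measurableSet
  have hlog (μ) := isEnergyMinimizer_iff continuous_logKernel.measurable hc0
    (fun p hp q hq => neg_le_logKernel (hc p hp q hq)) (μ := μ)
  have hred (ν) := isEnergyMinimizer_iff measurable_reducedKernel hc0 hcr (μ := ν)
  simp only [hlog, hred]
  have huniq {μ ν : MeasureTheory.Measure R3}
      (hμ : μ ∈ probOn (revolution A) ∧ ∀ ρ ∈ probOn (revolution A),
        shiftEnergy c logKernel μ ≤ shiftEnergy c logKernel ρ)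
      (hν : ν ∈ probOn (revolution A) ∧ ∀ ρ ∈ probOn (revolution A),
        shiftEnergy c logKernel ν ≤ shiftEnergy c logKernel ρ) : μ = ν :=
    eq_of_shiftEnergy_minimal hc hμ.1 hν.1 (ne_top_of_le_ne_top hfin₀ (hμ.2 _ hμ₀)) hμ.2 hν.2
  obtain ⟨μ₁, hμ₁, hmin₁⟩ := exists_minimizer_lintegral_prod (continuous_shiftKernel_logKernel c)
    (isCompact_revolution hA hAH) ⟨μ₀, hμ₀⟩
  refine ⟨⟨μ₁, ⟨hμ₁, hmin₁⟩, fun ν hν => huniq hν ⟨hμ₁, hmin₁⟩⟩, fun μ hμ => ?_⟩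
  have := hμ.1.1
  -- A rotated minimizer is again a minimizer, so uniqueness makes μ invariant.
  have hinv (t : ℝ) : μ.map (rotation t) = μ :=
    huniq ⟨map_rotation_mem_probOn hmA hAH t hμ.1, fun ρ hρ =>
      (shiftEnergy_map_rotation c t μ).trans_le (hμ.2 ρ hρ)⟩ hμ
  have heq := shiftEnergy_reducedMeasure hAH hc hμ.1 hinv
  have hmem := reducedMeasure_mem_probOn hmA hAH hμ.1
  refine ⟨⟨hmem, fun ν hν => ?_⟩, fun ν hν => ?_⟩
  · rw [heq, ← shiftEnergy_liftMeasure hAH hc hν]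
    exact hμ.2 _ (liftMeasure_mem_probOn hmA hAH hν)
  -- The lift of ν has energy J(ν) ≤ J(λ) = I₀(μ), up to the common shift, with λ the projection of
  -- μ. So it is a minimizer and equals μ.
  · have hlift : liftMeasure ν = μ := huniq ⟨liftMeasure_mem_probOn hmA hAH hν.1, fun ρ hρ => by
      rw [shiftEnergy_liftMeasure hAH hc hν.1]
      exact ((hν.2 _ hmem).trans_eq heq).trans (hμ.2 ρ hρ)⟩ hμ
    rw [← hlift, reducedMeasure_liftMeasure hAH hν.1]
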